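/- Let $T\ge 0$, let $N_1,\dots,N_T$ be pairwise disjoint finite sets of items and let $N=N_1\cup\dots\cup N_T$; items of $N_t$ can be allocated only to agent $t$. Let $M=(N,\mathcal I)$ be a matroid and $G=(N,E)$ a simple undirected graph. An allocation $(Y_1,\dots,Y_T)$ with $Y_t\subseteq N_t$ is feasible if $Y_1\cup\dots\cup Y_T$ is independent in $M$ (it lies in $\mathcal I$) and independent in $G$ (no two of its items are adjacent). Put $d_1(M)=0$ if $\mathcal I=2^N$ and $d_1(M)=1$ otherwise, and $$d_2(G)=\max_{t\in\{1,\dots,T\},\ i\in N_t}\alpha\Big(G\big[\{i'\in N_{t'}: t'<t,\ \{i,i'\}\in E\}\big]\Big),$$ where $G[\cdot]$ is the induced subgraph and $\alpha$ is the maximum size of an independent set (the maximum is $0$ if $N=\emptyset$). For each agent $t$, a random valuation function $v_t:2^{N_t}\to\mathbb R$ has a known distribution with finite support: $v_t=v_t^k$ with probability $p_t^k$, $k=1,\dots,K$, where $p_t^k\ge0$ and $\sum_k p_t^k=1$. Suppose that every realization $v_t^k$ (with $p_t^k>0$) is XOS, i.e. $v_t^k(S)=\max_{\ell\in\{1,\dots,L\}}w_\ell(S)$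 for all $S\subseteq N_t$, for some $L\ge 1$ and additive functions $w_1,\dots,w_L:2^{N_t}\to\mathbb R$ (additive: $w(S)+w(S')=w(S\cup S')$ for disjoint $S,S'$). An online algorithm sees the valuation functions $v_1,\dots,v_T$ one after another, in this order, and chooses $Y_t$ as a function of $v_1,\dots,v_t$ only, so that the final allocation is always feasible; it may depend on the sets $N_t$, on $M$, $G$ and on the distributions. Its expected welfare is $\mathbb E\big[\sum_t v_t(Y_t)\big]$ when $v_1,\dots,v_T$ are independent. Let $$\mathrm{OPT}=\sup_{D}\ \mathbb E_{(v_1,\dots,v_T)\sim D}\Big[\max_{(Y_1,\dots,Y_T)\text{ feasible}}\ \sum_{t=1}^T v_t(Y_t)\Big],$$ where $D$ ranges over all joint distributions of $(v_1,\dots,v_T)$ with the given marginals; that is, $\mathrm{OPT}$ is the expected welfare of a prophet who can choose the correlation between the valuation functions and sees all their realizations beforehand. Then there is a (deterministic) online algorithm whose expected welfare is at least $$\frac{1}{(d_1(M)+1)(d_2(G)+1)}\cdot\mathrm{OPT}.$$ -/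

import Mathlib

/-- A valuation function on a set `α` of items: a real value for every (finite) set of items. -/
abbrev SetValuation (α : Type*) := Finset α → ℝ

/-- `w` is additive: `w S + w S' = w (S ∪ S')` for all disjoint `S`, `S'`. -/
def IsAdditive {α : Type*} (w : SetValuation α) : Prop :=
  ∀ (S S' : Finset α) (h : Disjoint S S'), w S + w S' = w (S.disjUnion S' h)

/-- `v` is XOS (fractionally subadditive): it is the pointwise maximum of a finite collection
`w 1, …, w L` of additive functions. (The maximum is attained, so `L ≥ 1`.) -/
def IsXOS {α : Type*} (v : SetValuation α) : Prop :=
  ∃ (L : ℕ) (w : Fin L → SetValuation α), (∀ l, IsAdditive (w l)) ∧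
    ∀ S, IsGreatest (Set.range fun l => w l S) (v S)

/-- `d₁(M) = 0` if every subset of the ground set is independent, and `d₁(M) = 1` otherwise. -/
noncomputable def d1 {α : Type*} (M : Matroid α) : ℕ :=
  open Classical in if ∀ S ⊆ M.E, M.Indep S then 0 else 1

section Auction

variable {T : ℕ} {N : Fin T → Type*}

/-- The set of items of earlier agents that are adjacent to the item `i`
(`i.1` is the agent who may receive `i`). -/
def earlierNeighbors (G : SimpleGraph (Σ t, N t)) (i : Σ t, N t) : Set (Σ t, N t) :=
  {i' | G.Adj i i' ∧ i'.1 < i.1}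

/-- `d₂(G)`: the maximum, over all items `i`, of the independence number of the subgraph of `G`
induced by the neighbours of `i` that belong to earlier agents (`0` if there is no item). -/
noncomputable def d2 [∀ t, Fintype (N t)] (G : SimpleGraph (Σ t, N t)) : ℕ :=
  Finset.univ.sup fun i => (G.induce (earlierNeighbors G i)).indepNum

/-- The union `Y₁ ∪ … ∪ Y_T` of the sets of items in an allocation. -/
def allocated (Y : ∀ t, Finset (N t)) : Finset (Σ t, N t) :=
  Finset.univ.sigma Y

/-- An allocation is feasible if the set of all allocated items is independent both in the
matroid and in the graph. -/
def Feasible (M : Matroid (Σ t, N t)) (G : SimpleGraph (Σ t, N t))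
    (Y : ∀ t, Finset (N t)) : Prop :=
  M.Indep (allocated Y : Set (Σ t, N t)) ∧ G.IsIndepSet (allocated Y : Set (Σ t, N t))

/-- The welfare `∑ₜ vₜ(Yₜ)`. -/
def welfare (v : ∀ t, SetValuation (N t)) (Y : ∀ t, Finset (N t)) : ℝ :=
  ∑ t, v t (Y t)

theorem feasible_empty (M : Matroid (Σ t, N t)) (G : SimpleGraph (Σ t, N t)) :
    Feasible M G (fun _ => ∅) := by
  have h : allocated (fun t => (∅ : Finset (N t))) = ∅ := by
    ext i; simp [allocated]
  simp [Feasible, h, SimpleGraph.IsIndepSet]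

/-- The maximum welfare of a feasible allocation for a known profile of valuation functions. -/
noncomputable def maxWelfare [∀ t, Fintype (N t)] (M : Matroid (Σ t, N t))
    (G : SimpleGraph (Σ t, N t)) (v : ∀ t, SetValuation (N t)) : ℝ :=
  open Classical in
  (Finset.univ.filter (Feasible M G)).sup' ⟨fun _ => ∅, by simp [feasible_empty]⟩ (welfare v)

/-- A (deterministic) online algorithm. It maps a profile of valuation functions to an allocation
that is feasible, and the set given to agent `t` depends only on the valuation functions of the
agents up to and including `t`. -/
structure OnlineAlgorithm (M : Matroid (Σ t, N t)) (G : SimpleGraph (Σ t, N t)) where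
  alloc : (∀ t, SetValuation (N t)) → ∀ t, Finset (N t)
  feasible : ∀ v, Feasible M G (alloc v)
  nonanticipating : ∀ v v' t, (∀ s ≤ t, v s = v' s) → alloc v t = alloc v' t

/-- The profile of valuation functions when agent `t` realizes to her `k t`-th function. -/
def profile {K : ℕ} (v : ∀ t, Fin K → SetValuation (N t)) (k : Fin T → Fin K) :
    ∀ t, SetValuation (N t) :=
  fun t => v t (k t)

/-- The expected welfare of an online algorithm, when the valuation functions of the agents realize
independently, and that of agent `t` is `v t k` with probability `p t k`. -/
noncomputable def expectedWelfare {K : ℕ} {M : Matroid (Σ t, N t)} {G : SimpleGraph (Σ t, N t)}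
    (A : OnlineAlgorithm M G) (p : Fin T → Fin K → ℝ) (v : ∀ t, Fin K → SetValuation (N t)) : ℝ :=
  ∑ k : Fin T → Fin K, (∏ t, p t (k t)) * welfare (profile v k) (A.alloc (profile v k))

/-- `q` is a joint distribution of the realizations of all agents with marginals `p`. -/
structure IsCoupling {K : ℕ} (p : Fin T → Fin K → ℝ) (q : (Fin T → Fin K) → ℝ) : Prop where
  nonneg : ∀ k, 0 ≤ q k
  sum_eq_one : ∑ k, q k = 1
  marginal : ∀ t j, ∑ k with k t = j, q k = p t j

/-- The expected welfare of the prophet under the joint distribution `q`: he sees the realizations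
of all valuation functions and picks a feasible allocation of maximum welfare. -/
noncomputable def prophetWelfare [∀ t, Fintype (N t)] {K : ℕ} (M : Matroid (Σ t, N t))
    (G : SimpleGraph (Σ t, N t)) (v : ∀ t, Fin K → SetValuation (N t))
    (q : (Fin T → Fin K) → ℝ) : ℝ :=
  ∑ k, q k * maxWelfare M G (profile v k)

/-- `OPT`: the supremum of the prophet's expected welfare over all joint distributions with the
given marginals. -/
noncomputable def OPT [∀ t, Fintype (N t)] {K : ℕ} (M : Matroid (Σ t, N t))
    (G : SimpleGraph (Σ t, N t)) (p : Fin T → Fin K → ℝ) (v : ∀ t, Fin K → SetValuation (N t)) : ℝ :=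
  sSup {w | ∃ q, IsCoupling p q ∧ w = prophetWelfare M G v q}

/-- The independent product is a coupling. -/
theorem isCoupling_prod {K : ℕ} (p : Fin T → Fin K → ℝ) (hp0 : ∀ t k, 0 ≤ p t k)
    (hp1 : ∀ t, ∑ k, p t k = 1) : IsCoupling p (fun k => ∏ t, p t (k t)) where
  nonneg k := Finset.prod_nonneg fun t _ => hp0 t (k t)
  sum_eq_one := by
    have h := Finset.prod_univ_sum (fun _ => Finset.univ) p
    rw [Fintype.piFinset_univ] at h
    rw [← h]
    simp [hp1]
  marginal t j := by
    have h := Finset.prod_univ_sum (fun s => if s = t then {j} else Finset.univ) p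
    have h2 : (Fintype.piFinset fun s => if s = t then ({j} : Finset (Fin K)) else Finset.univ)
        = Finset.univ.filter fun k => k t = j := by
      ext k
      simp only [Fintype.mem_piFinset, Finset.mem_filter, Finset.mem_univ, true_and]
      constructor
      · intro hk; simpa using hk t
      · rintro hk s
        by_cases hs : s = t
        · subst hs; simp [hk]
        · simp [hs]
    rw [h2] at h
    rw [← h, Finset.prod_eq_single t]
    · simp
    · intro s _ hs; simp [hs, hp1]
    · simp

/-- The supremum that defines `OPT` is over a set that is bounded above. -/
theorem bddAbove_prophetWelfare [∀ t, Fintype (N t)] {K : ℕ} (M : Matroid (Σ t, N t))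
    (G : SimpleGraph (Σ t, N t)) (p : Fin T → Fin K → ℝ) (v : ∀ t, Fin K → SetValuation (N t)) :
    BddAbove {w | ∃ q, IsCoupling p q ∧ w = prophetWelfare M G v q} := by
  refine ⟨∑ k, |maxWelfare M G (profile v k)|, ?_⟩
  rintro w ⟨q, hq, rfl⟩
  refine Finset.sum_le_sum fun k _ => ?_
  have h1 : q k ≤ 1 := hq.sum_eq_one ▸
    Finset.single_le_sum (fun k _ => hq.nonneg k) (Finset.mem_univ k)
  calc q k * maxWelfare M G (profile v k) ≤ q k * |maxWelfare M G (profile v k)| :=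
        mul_le_mul_of_nonneg_left (le_abs_self _) (hq.nonneg k)
    _ ≤ 1 * |maxWelfare M G (profile v k)| := mul_le_mul_of_nonneg_right h1 (abs_nonneg _)
    _ = _ := one_mul _

/-- No joint distribution with the given marginals gives a prophet more than `OPT`. -/
theorem prophetWelfare_le_OPT [∀ t, Fintype (N t)] {K : ℕ} (M : Matroid (Σ t, N t))
    (G : SimpleGraph (Σ t, N t)) (p : Fin T → Fin K → ℝ) (v : ∀ t, Fin K → SetValuation (N t))
    (q : (Fin T → Fin K) → ℝ) (hq : IsCoupling p q) : prophetWelfare M G v q ≤ OPT M G p v :=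
  le_csSup (bddAbove_prophetWelfare M G p v) ⟨q, hq, rfl⟩

end Auction

/-! Fix a coupling `q`. In each outcome take an optimal offline allocation `R` and, by XOS, additive
weights `w` that are exact on `R` and underestimate the valuations on all other sets. The best
online welfare is the value of a dynamic program, so it suffices to bound that value from below by
the factor times E[w(R)].

Graph: backward in the agents, give item i the price θ_i = E[1{i ∈ R} (w_i - c_i)⁺], where c_i sums
the prices of its later neighbours. An independent `R` contains at most d₂ earlier neighbours of any
item, so E[c(R)] ≤ d₂ Σθ. Hence E[w(R)] ≤ (d₂ + 1) Σθ, and Σθ is the expected net weight (w - c)⁺ of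
`R`.

Matroid: drop the graph and let every agent draw a fresh outcome and receive a subset of her part of
`R`, at net weights. This relaxed program is worth at least Σθ / (d₁ + 1): take everything if the
matroid is free; otherwise use balanced prices, half of the expected loss of the residual greedy
value (`exists_greedyValue`, `half_le_matroidValue`).

Putting the graph back (`matroidValue_sub_le_onlineValue`): skip blocked items. The total price of
the blocked items still to come is a potential that pays for what is skipped; whoever blocks an item
pays for the increase out of c_i. Each fresh outcome can be drawn conditionally on the agent's own
valuation, so only the marginals of `q` matter online. -/

/-! ### Matroid rank and the residual greedy value -/

section MatroidRank

variable {α : Type*} (M : Matroid α)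

/-- The rank of a finite set, as a real number. -/
noncomputable def realRk (X : Finset α) : ℝ := ((M.eRk (X : Set α)).toNat : ℝ)

theorem eRk_finset_ne_top (X : Finset α) : M.eRk (X : Set α) ≠ ⊤ :=
  Matroid.eRk_ne_top_iff.2 (M.isRkFinite_of_finite X.finite_toSet)

theorem realRk_mono {X Y : Finset α} (h : X ⊆ Y) : realRk M X ≤ realRk M Y := by
  unfold realRk
  exact_mod_cast ENat.toNat_le_toNat (M.eRk_mono (by exact_mod_cast h)) (eRk_finset_ne_top M Y)

theorem realRk_le_card (X : Finset α) : realRk M X ≤ X.card := by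
  unfold realRk
  have h := ENat.toNat_le_toNat (M.eRk_le_encard (X : Set α)) (by simp)
  simp only [Set.encard_coe_eq_coe_finsetCard, ENat.toNat_natCast] at h
  exact_mod_cast h

theorem realRk_of_indep {M : Matroid α} {X : Finset α} (h : M.Indep (X : Set α)) : realRk M X = X.card := by
  simp [realRk, h.eRk_eq_encard]

variable [DecidableEq α]

theorem realRk_submod (X Y : Finset α) :
    realRk M (X ∩ Y) + realRk M (X ∪ Y) ≤ realRk M X + realRk M Y := by
  have h := M.eRk_inter_add_eRk_union_le (X : Set α) Y
  rw [← Finset.coe_inter, ← Finset.coe_union] at h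
  have h2 := ENat.toNat_le_toNat h (by simp)
  rw [ENat.toNat_add (eRk_finset_ne_top M _) (eRk_finset_ne_top M _),
    ENat.toNat_add (eRk_finset_ne_top M _) (eRk_finset_ne_top M _)] at h2
  unfold realRk
  exact_mod_cast h2

theorem realRk_union_sub_le_card (X Y : Finset α) :
    realRk M (X ∪ Y) - realRk M X ≤ Y.card := by
  have h := realRk_submod M X Y
  have h2 := realRk_le_card M Y
  have h3 : 0 ≤ realRk M (X ∩ Y) := by unfold realRk; positivity
  linarith

theorem realRk_marginal_anti {Z Z' : Finset α} (h : Z ⊆ Z') (S : Finset α) :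
    realRk M (Z' ∪ S) - realRk M Z' ≤ realRk M (Z ∪ S) - realRk M Z := by
  have h1 := realRk_submod M Z' (Z ∪ S)
  have h2 : realRk M Z ≤ realRk M (Z' ∩ (Z ∪ S)) :=
    realRk_mono M (Finset.subset_inter h Finset.subset_union_left)
  have h3 : Z' ∪ (Z ∪ S) = Z' ∪ S := by
    rw [← Finset.union_assoc, Finset.union_eq_left.2 h]
  rw [h3] at h1
  linarith

theorem realRk_union_biUnion_sub_le {ι : Type*} (Z : Finset α) (s : Finset ι)
    (V : ι → Finset α) :
    realRk M (Z ∪ s.biUnion V) - realRk M Z ≤ ∑ t ∈ s, (realRk M (Z ∪ V t) - realRk M Z) := by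
  classical
  induction s using Finset.induction_on with
  | empty => simp
  | insert a s ha ih =>
    rw [Finset.sum_insert ha, Finset.biUnion_insert]
    have h := realRk_marginal_anti M (Finset.subset_union_left : Z ⊆ Z ∪ s.biUnion V) (V a)
    have e : Z ∪ s.biUnion V ∪ V a = Z ∪ (V a ∪ s.biUnion V) := by
      rw [Finset.union_assoc, Finset.union_comm (s.biUnion V)]
    rw [e] at h
    linarith

/-- The rank of `R` after contracting `Y`. -/
noncomputable def contractRk (R Y : Finset α) : ℝ := realRk M (R ∪ Y) - realRk M Y

/-- Each loss is the rank gain of `V t` over `Y t`, at most |V t|, minus its gain over `R ∪ Y t`, at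
least its gain over `R ∪ A`. With V the union, subadditivity of gains bounds the sum by |V| - r(R ∪
A ∪ V) + r(R ∪ A), and r(R ∪ A ∪ V) ≥ |A| + |V| by independence. -/
theorem sum_contractRk_loss_le {ι : Type*} (R A : Finset α) (s : Finset ι) (Y V : ι → Finset α)
    (hY : ∀ t ∈ s, Y t ⊆ A) (hV : (s : Set ι).PairwiseDisjoint V)
    (hAV : Disjoint A (s.biUnion V)) (hI : M.Indep (A ∪ s.biUnion V : Finset α)) :
    ∑ t ∈ s, (contractRk M R (Y t) - contractRk M R (Y t ∪ V t)) ≤ contractRk M R A := by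
  have h1 : ∀ t ∈ s, contractRk M R (Y t) - contractRk M R (Y t ∪ V t) ≤
      ((V t).card : ℝ) - (realRk M (R ∪ A ∪ V t) - realRk M (R ∪ A)) := by
    intro t ht
    have a1 := realRk_union_sub_le_card M (Y t) (V t)
    have a2 := realRk_marginal_anti M
      (Finset.union_subset_union_right (hY t ht) : R ∪ Y t ⊆ R ∪ A) (V t)
    unfold contractRk
    rw [← Finset.union_assoc]
    linarith
  refine (Finset.sum_le_sum h1).trans ?_
  rw [Finset.sum_sub_distrib]
  have h2 := realRk_union_biUnion_sub_le M (R ∪ A) s V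
  have h3 := realRk_of_indep hI
  have h4 := realRk_of_indep (hI.subset (by simp : (A : Set α) ⊆ (A ∪ s.biUnion V : Finset α)))
  rw [Finset.card_union_of_disjoint hAV, Finset.card_biUnion hV] at h3
  have h5 : realRk M (A ∪ s.biUnion V) ≤ realRk M (R ∪ A ∪ s.biUnion V) :=
    realRk_mono M (by rw [Finset.union_assoc]; exact Finset.subset_union_right)
  push_cast at h3
  unfold contractRk
  linarith

/-- Extending an independent set `A ∪ V'` inside `A ∪ R` to a basis. -/
theorem exists_extension_card_eq {A V' R : Finset α} (hV' : V' ⊆ R)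
    (hdisj : Disjoint A V') (hI : M.Indep (A ∪ V' : Finset α)) :
    ∃ V, V' ⊆ V ∧ V ⊆ R ∧ Disjoint A V ∧ M.Indep (A ∪ V : Finset α) ∧
      (V.card : ℝ) = contractRk M R A := by
  obtain ⟨B, hB, hsub⟩ := hI.subset_isBasis'_of_subset
    (show ((A ∪ V' : Finset α) : Set α) ⊆ (R ∪ A : Finset α) by
      rw [Finset.union_comm]; exact_mod_cast Finset.union_subset_union_left hV')
  have hBfin : B.Finite := (R ∪ A).finite_toSet.subset hB.subset
  lift B to Finset α using hBfin
  have hsub' : A ∪ V' ⊆ B := by exact_mod_cast hsub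
  have hBR : B ⊆ R ∪ A := by exact_mod_cast hB.subset
  have hAB : A ⊆ B := Finset.subset_union_left.trans hsub'
  have hE : A ∪ B \ A = B := Finset.union_sdiff_of_subset hAB
  refine ⟨B \ A, ?_, ?_, Finset.disjoint_sdiff, ?_, ?_⟩
  · intro x hx
    exact Finset.mem_sdiff.2 ⟨hsub' (Finset.mem_union_right _ hx),
      fun h => Finset.disjoint_left.1 hdisj h hx⟩
  · intro x hx
    have hx := Finset.mem_sdiff.1 hx
    exact (Finset.mem_union.1 (hBR hx.1)).resolve_right hx.2
  · rw [hE]; exact hB.indep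
  · have h1 : realRk M B = realRk M (R ∪ A) := by
      unfold realRk; rw [hB.eRk_eq_eRk]
    have h2 := realRk_of_indep hB.indep
    have h3 := realRk_of_indep (hB.indep.subset (by exact_mod_cast hAB : (A : Set α) ⊆ B))
    rw [Finset.card_sdiff_of_subset hAB, Nat.cast_sub (Finset.card_le_card hAB), contractRk, ← h1,
      h2, h3]

/-- The greedy value `h Y` of the part of `R` that can still be added to `Y`. It is a nonnegative
combination of the functions `contractRk M R' ·`, where `R'` runs over the upper level sets
of the weight on `R`. -/
theorem exists_greedyValue (ι : Type*) (R : Finset α) (w : α → ℝ) (hw : ∀ i ∈ R, 0 ≤ w i) :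
    ∃ h : Finset α → ℝ,
      (M.Indep (R : Set α) → h ∅ = ∑ i ∈ R, w i) ∧
      (∀ A : Finset α, M.Indep (A : Set α) → ∃ V ⊆ R, Disjoint A V ∧
        M.Indep (A ∪ V : Finset α) ∧ h A ≤ ∑ i ∈ V, w i) ∧
      ∀ (s : Finset ι) (A : Finset α) (Y V : ι → Finset α), (∀ t ∈ s, Y t ⊆ A) →
        (s : Set ι).PairwiseDisjoint V → Disjoint A (s.biUnion V) →
        M.Indep (A ∪ s.biUnion V : Finset α) →
        ∑ t ∈ s, (h (Y t) - h (Y t ∪ V t)) ≤ h A := by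
  induction hn : R.card generalizing R w with
  | zero =>
    obtain rfl := Finset.card_eq_zero.1 hn
    refine ⟨fun _ => 0, by simp, fun A hA => ⟨∅, by simp, by simp, by simpa using hA, by simp⟩,
      by simp⟩
  | succ n ih =>
    -- Peel off the lowest level: on `R`, `w` is the constant `w a` plus a nonnegative weight that
    -- vanishes at `a`.
    obtain ⟨a, ha, hmin⟩ := R.exists_min_image w (Finset.card_pos.1 (by omega))
    obtain ⟨h, h0, hgreedy, hloss⟩ := ih (R.erase a) (fun i => w i - w a)
      (fun i hi => sub_nonneg.2 (hmin i (Finset.mem_of_mem_erase hi)))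
      (by rw [Finset.card_erase_of_mem ha, hn]; rfl)
    refine ⟨fun Y => w a * contractRk M R Y + h Y, ?_, ?_, ?_⟩
    · intro hR
      have e1 : contractRk M R ∅ = R.card := by
        have : realRk M ∅ = 0 := by simp [realRk]
        rw [contractRk, Finset.union_empty, realRk_of_indep hR, this, sub_zero]
      have e2 := Finset.sum_erase_add R (fun i => w i - w a) ha
      simp only [h0 (hR.subset (by simp)), e1]
      simp only [sub_self, add_zero] at e2
      rw [e2, Finset.sum_sub_distrib]
      simp [mul_comm]
    · intro A hA
      obtain ⟨V', hV'R, hdis, hI, hle⟩ := hgreedy A hA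
      -- Extending `V'`, as the greedy algorithm does, lets one `V` serve all levels at once; the
      -- added elements have `w i - w a ≥ 0`.
      obtain ⟨V, hVV, hVR, hd, hVI, hcard⟩ :=
        exists_extension_card_eq M (hV'R.trans (Finset.erase_subset a R)) hdis hI
      refine ⟨V, hVR, hd, hVI, ?_⟩
      have e1 : ∑ i ∈ V', (w i - w a) ≤ ∑ i ∈ V, (w i - w a) :=
        Finset.sum_le_sum_of_subset_of_nonneg hVV
          fun i hi _ => sub_nonneg.2 (hmin i (hVR hi))
      rw [Finset.sum_sub_distrib (s := V), Finset.sum_const, nsmul_eq_mul, hcard] at e1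
      linarith
    · intro s A Y V hY hV hAV hI
      have e1 := hloss s A Y V hY hV hAV hI
      have e2 := mul_le_mul_of_nonneg_left (sum_contractRk_loss_le M R A s Y V hY hV hAV hI)
        (hw a ha)
      rw [Finset.mul_sum] at e2
      refine le_trans (le_of_eq ?_) (add_le_add e2 e1)
      rw [← Finset.sum_add_distrib]
      exact Finset.sum_congr rfl fun t _ => by ring

end MatroidRank

/-! ### Dynamic programming and the optimal online algorithm -/

section DynamicProgram

open scoped Classical

variable {T : ℕ} {N : Fin T → Type*}

/-- A set of items of agent `t`, as a set of items. -/
def agentItems (t : Fin T) (S : Finset (N t)) : Finset (Σ t, N t) :=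
  S.map (Function.Embedding.sigmaMk t)

@[simp] theorem mem_agentItems {t : Fin T} {S : Finset (N t)} {i : Σ t, N t} :
    i ∈ agentItems t S ↔ ∃ a ∈ S, (⟨t, a⟩ : Σ t, N t) = i := by
  simp [agentItems]

@[simp] theorem agentItems_empty (t : Fin T) : agentItems t (∅ : Finset (N t)) = ∅ := rfl

theorem sum_agentItems {t : Fin T} (S : Finset (N t)) (f : (Σ t, N t) → ℝ) :
    ∑ i ∈ agentItems t S, f i = ∑ a ∈ S, f ⟨t, a⟩ := by
  simp [agentItems]

theorem allocated_eq_biUnion (Y : ∀ t, Finset (N t)) :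
    allocated Y = Finset.univ.biUnion fun t => agentItems t (Y t) := by
  ext ⟨t, a⟩
  simp only [allocated, Finset.mem_sigma, Finset.mem_univ, true_and, Finset.mem_biUnion,
    mem_agentItems]
  constructor
  · exact fun h => ⟨t, a, h, rfl⟩
  · rintro ⟨s, b, hb, h⟩
    cases h
    exact hb

/-- The sets from the menu `D` that keep the state in `F`; the empty set is always available. -/
noncomputable def dpOptions (F : Finset (Σ t, N t) → Prop) (t : Fin T) (D : Finset (Finset (N t)))
    (Y : Finset (Σ t, N t)) : Finset (Finset (N t)) :=
  insert ∅ (D.filter fun S => F (Y ∪ agentItems t S))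

/-- The best sum of the reward of the current agent and of the value of the next state. -/
noncomputable def dpBest (F : Finset (Σ t, N t) → Prop) (next : Finset (Σ t, N t) → ℝ) (t : Fin T)
    (D : Finset (Finset (N t))) (r : Finset (N t) → ℝ) (Y : Finset (Σ t, N t)) : ℝ :=
  (dpOptions F t D Y).sup' (Finset.insert_nonempty _ _) fun S => r S + next (Y ∪ agentItems t S)

theorem mem_dpOptions {F : Finset (Σ t, N t) → Prop} {t : Fin T} {D : Finset (Finset (N t))}
    {Y : Finset (Σ t, N t)} {S : Finset (N t)} :
    S ∈ dpOptions F t D Y ↔ S = ∅ ∨ S ∈ D ∧ F (Y ∪ agentItems t S) := by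
  simp [dpOptions]

theorem le_dpBest {F : Finset (Σ t, N t) → Prop} (next : Finset (Σ t, N t) → ℝ) {t : Fin T}
    {D : Finset (Finset (N t))} (r : Finset (N t) → ℝ) {Y : Finset (Σ t, N t)} {S : Finset (N t)}
    (hS : S ∈ dpOptions F t D Y) : r S + next (Y ∪ agentItems t S) ≤ dpBest F next t D r Y :=
  Finset.le_sup' (fun S => r S + next (Y ∪ agentItems t S)) hS

theorem exists_eq_dpBest (F : Finset (Σ t, N t) → Prop) (next : Finset (Σ t, N t) → ℝ) (t : Fin T)
    (D : Finset (Finset (N t))) (r : Finset (N t) → ℝ) (Y : Finset (Σ t, N t)) :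
    ∃ S ∈ dpOptions F t D Y, r S + next (Y ∪ agentItems t S) = dpBest F next t D r Y := by
  obtain ⟨S, hS, h⟩ := Finset.exists_mem_eq_sup' (Finset.insert_nonempty _ _ :
    (dpOptions F t D Y).Nonempty) (fun S => r S + next (Y ∪ agentItems t S))
  exact ⟨S, hS, h.symm⟩

variable {Θ : Type*} [Fintype Θ]

/-- The optimal value-to-go, at time `n` in state `Y`, of the problem in which agent `t` has type
`θ` with probability `μ t θ`; the menu is then `D t θ` and the reward is `r t θ`. -/
noncomputable def dpValue (F : Finset (Σ t, N t) → Prop) (μ : Fin T → Θ → ℝ)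
    (D : ∀ t, Θ → Finset (Finset (N t))) (r : ∀ t, Θ → Finset (N t) → ℝ) (n : ℕ)
    (Y : Finset (Σ t, N t)) : ℝ :=
  if h : n < T then
    ∑ θ, μ ⟨n, h⟩ θ * dpBest F (fun Z => dpValue F μ D r (n + 1) Z) ⟨n, h⟩ (D ⟨n, h⟩ θ)
      (r ⟨n, h⟩ θ) Y
  else 0
termination_by T - n

theorem dpValue_fin (F : Finset (Σ t, N t) → Prop) (μ : Fin T → Θ → ℝ)
    (D : ∀ t, Θ → Finset (Finset (N t))) (r : ∀ t, Θ → Finset (N t) → ℝ) (t : Fin T)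
    (Y : Finset (Σ t, N t)) :
    dpValue F μ D r t Y =
      ∑ θ, μ t θ * dpBest F (dpValue F μ D r (t + 1)) t (D t θ) (r t θ) Y := by
  rw [dpValue, dif_pos t.2]

theorem dpValue_end (F : Finset (Σ t, N t) → Prop) (μ : Fin T → Θ → ℝ)
    (D : ∀ t, Θ → Finset (Finset (N t))) (r : ∀ t, Θ → Finset (N t) → ℝ)
    (Y : Finset (Σ t, N t)) : dpValue F μ D r T Y = 0 := by
  rw [dpValue, dif_neg (lt_irrefl T)]

theorem backward_induction {P : ℕ → Prop} (hT : P T) (hstep : ∀ t : Fin T, P (t + 1) → P t)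
    (n : ℕ) (hn : n ≤ T) : P n :=
  Nat.decreasingInduction (motive := fun n _ => P n) (fun n hn h => hstep ⟨n, hn⟩ h) hT hn

section Policy

variable [∀ t, Fintype (N t)]

/-- An optimal set for an agent with valuation function `u`. -/
noncomputable def dpChoice (F : Finset (Σ t, N t) → Prop) (next : ℕ → Finset (Σ t, N t) → ℝ)
    (t : Fin T) (u : SetValuation (N t)) (Y : Finset (Σ t, N t)) : Finset (N t) :=
  (exists_eq_dpBest F (next (t + 1)) t Finset.univ u Y).choose

/-- The set of items allocated before time `n`. -/
noncomputable def dpState (F : Finset (Σ t, N t) → Prop) (next : ℕ → Finset (Σ t, N t) → ℝ)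
    (v : ∀ t, SetValuation (N t)) : ℕ → Finset (Σ t, N t)
  | 0 => ∅
  | n + 1 =>
    if h : n < T then
      dpState F next v n ∪ agentItems ⟨n, h⟩ (dpChoice F next ⟨n, h⟩ (v ⟨n, h⟩) (dpState F next v n))
    else dpState F next v n

variable (F : Finset (Σ t, N t) → Prop) (next : ℕ → Finset (Σ t, N t) → ℝ)

theorem dpState_succ (v : ∀ t, SetValuation (N t)) (t : Fin T) :
    dpState F next v (t + 1) =
      dpState F next v t ∪ agentItems t (dpChoice F next t (v t) (dpState F next v t)) := by
  rw [dpState, dif_pos t.2]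

theorem dpState_congr {v v' : ∀ t, SetValuation (N t)} {n : ℕ}
    (h : ∀ s : Fin T, (s : ℕ) < n → v s = v' s) : dpState F next v n = dpState F next v' n := by
  induction n with
  | zero => rfl
  | succ n ih =>
    have ih := ih fun s hs => h s (by omega)
    by_cases hn : n < T
    · have e := h ⟨n, hn⟩ (by simp)
      simp only [dpState, dif_pos hn, ih, e]
    · simp only [dpState, dif_neg hn, ih]

theorem dpState_mem (h0 : F ∅) (v : ∀ t, SetValuation (N t)) (n : ℕ) : F (dpState F next v n) := by
  induction n with
  | zero => exact h0
  | succ n ih =>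
    by_cases hn : n < T
    · rw [dpState, dif_pos hn]
      have h := (exists_eq_dpBest F (next (n + 1)) ⟨n, hn⟩ Finset.univ (v ⟨n, hn⟩)
        (dpState F next v n)).choose_spec.1
      rcases mem_dpOptions.1 h with h | h
      · unfold dpChoice
        rw [h]
        simpa using ih
      · exact h.2
    · rwa [dpState, dif_neg hn]

theorem dpState_eq_biUnion (v : ∀ t, SetValuation (N t)) (n : ℕ) :
    dpState F next v n = (Finset.univ.filter fun t : Fin T => (t : ℕ) < n).biUnion
      fun t => agentItems t (dpChoice F next t (v t) (dpState F next v t)) := by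
  induction n with
  | zero => simp [dpState]
  | succ n ih =>
    by_cases hn : n < T
    · have e : (Finset.univ.filter fun t : Fin T => (t : ℕ) < n + 1) =
          insert ⟨n, hn⟩ (Finset.univ.filter fun t : Fin T => (t : ℕ) < n) := by
        ext t; simp [Fin.ext_iff]; omega
      rw [e, Finset.biUnion_insert, ← ih, Finset.union_comm]
      exact dpState_succ F next v ⟨n, hn⟩
    · have e : (Finset.univ.filter fun t : Fin T => (t : ℕ) < n + 1) =
          Finset.univ.filter fun t : Fin T => (t : ℕ) < n := by
        ext t; have := t.2; simp; omega
      rw [e, ← ih, dpState, dif_neg hn]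

theorem allocated_dpChoice (v : ∀ t, SetValuation (N t)) :
    allocated (fun t => dpChoice F next t (v t) (dpState F next v t)) = dpState F next v T := by
  rw [allocated_eq_biUnion, dpState_eq_biUnion F next v T]
  simp

end Policy

/-- Resampling one coordinate of a product distribution. -/
theorem sum_prod_mul_resample {K : ℕ} (p : Fin T → Fin K → ℝ) (hp1 : ∀ t, ∑ k, p t k = 1)
    (t : Fin T) (f : (Fin T → Fin K) → Fin K → ℝ)
    (hf : ∀ k j l, f (Function.update k t j) l = f k l) :
    ∑ k : Fin T → Fin K, (∏ s, p s (k s)) * ∑ j, p t j * f k j =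
      ∑ k : Fin T → Fin K, (∏ s, p s (k s)) * f k (k t) := by
  have hswap : ∀ k j, (∏ s, p s (Function.update k t j s)) * p t (k t) =
      (∏ s, p s (k s)) * p t j := by
    intro k j
    rw [← Finset.mul_prod_erase _ _ (Finset.mem_univ t),
      ← Finset.mul_prod_erase _ (fun s => p s (k s)) (Finset.mem_univ t),
      Finset.prod_congr rfl (g := fun s => p s (k s))
        (fun s hs => by rw [Function.update_of_ne (Finset.ne_of_mem_erase hs)])]
    simp only [Function.update_self]
    ring
  let e : ((Fin T → Fin K) × Fin K) → ((Fin T → Fin K) × Fin K) :=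
    fun x => (Function.update x.1 t x.2, x.1 t)
  have he : Function.Involutive e := by
    rintro ⟨k, j⟩
    simp [e]
  calc ∑ k : Fin T → Fin K, (∏ s, p s (k s)) * ∑ j, p t j * f k j
      = ∑ x : (Fin T → Fin K) × Fin K, (∏ s, p s (x.1 s)) * (p t x.2 * f x.1 x.2) := by
        rw [Fintype.sum_prod_type]
        simp only [Finset.mul_sum]
    _ = ∑ x : (Fin T → Fin K) × Fin K,
          (∏ s, p s ((e x).1 s)) * (p t (e x).2 * f (e x).1 (e x).2) :=
        (Equiv.sum_comp he.toPerm
          fun x => (∏ s, p s (x.1 s)) * (p t x.2 * f x.1 x.2)).symm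
    _ = ∑ x : (Fin T → Fin K) × Fin K, p t x.2 * ((∏ s, p s (x.1 s)) * f x.1 (x.1 t)) := by
        refine Finset.sum_congr rfl fun x _ => ?_
        simp only [e]
        rw [← mul_assoc, hswap, hf]
        ring
    _ = _ := by
        rw [Fintype.sum_prod_type]
        refine Finset.sum_congr rfl fun k _ => ?_
        simp only [← Finset.sum_mul, hp1, one_mul]

variable [∀ t, Fintype (N t)]

/-- A set of items that is independent in the matroid and in the graph. -/
def JointlyIndep (M : Matroid (Σ t, N t)) (G : SimpleGraph (Σ t, N t)) (Y : Finset (Σ t, N t)) :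
    Prop :=
  M.Indep (Y : Set (Σ t, N t)) ∧ G.IsIndepSet (Y : Set (Σ t, N t))

/-- The optimal value-to-go of an online algorithm. -/
noncomputable def onlineValue {K : ℕ} (M : Matroid (Σ t, N t)) (G : SimpleGraph (Σ t, N t))
    (p : Fin T → Fin K → ℝ) (v : ∀ t, Fin K → SetValuation (N t)) :
    ℕ → Finset (Σ t, N t) → ℝ :=
  dpValue (JointlyIndep M G) p (fun _ _ => Finset.univ) v

/-- Follow an optimal choice at every state. The expected value-to-go along the trajectory then
drops at step `t` by exactly the expected reward of agent `t`, and the drops telescope. -/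
theorem exists_algorithm_expectedWelfare_eq {K : ℕ} (M : Matroid (Σ t, N t))
    (G : SimpleGraph (Σ t, N t)) (p : Fin T → Fin K → ℝ) (hp1 : ∀ t, ∑ k, p t k = 1)
    (v : ∀ t, Fin K → SetValuation (N t)) :
    ∃ A : OnlineAlgorithm M G, expectedWelfare A p v = onlineValue M G p v 0 ∅ := by
  set F := JointlyIndep M G with hF
  set V := onlineValue M G p v with hV
  have hF0 : F ∅ := by simp [hF, JointlyIndep, SimpleGraph.IsIndepSet]
  refine ⟨⟨fun v t => dpChoice F V t (v t) (dpState F V v t), fun v => ?_, ?_⟩, ?_⟩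
  · have h := dpState_mem F V hF0 v T
    rwa [← allocated_dpChoice] at h
  · intro v v' t h
    simp only [h t le_rfl, dpState_congr F V (n := t) fun s hs => h s (le_of_lt hs)]
  · set g : ℕ → ℝ := fun n =>
      ∑ k : Fin T → Fin K, (∏ s, p s (k s)) * V n (dpState F V (profile v k) n) with hg
    have hstep : ∀ t : Fin T, g t - g (t + 1) = ∑ k : Fin T → Fin K, (∏ s, p s (k s)) *
        v t (k t) (dpChoice F V t (v t (k t)) (dpState F V (profile v k) t)) := by
      intro t
      -- The state at time `t` ignores coordinate `t`, so the average over a fresh valuation in the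
      -- Bellman equation may be evaluated at the realized one.
      have h := sum_prod_mul_resample p hp1 t
        (fun k j => dpBest F (V (t + 1)) t Finset.univ (v t j) (dpState F V (profile v k) t))
        (fun k j l => by
          rw [dpState_congr F V (v := profile v (Function.update k t j)) (v' := profile v k)]
          intro s hs
          have : s ≠ t := by rintro rfl; exact lt_irrefl _ hs
          simp [profile, Function.update_of_ne this])
      have e : g t = ∑ k : Fin T → Fin K, (∏ s, p s (k s)) * ∑ j, p t j *
          dpBest F (V (t + 1)) t Finset.univ (v t j) (dpState F V (profile v k) t) := by
        simp only [hg, hV, onlineValue, dpValue_fin, ← hF]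
      rw [e, h, sub_eq_iff_eq_add, hg, ← Finset.sum_add_distrib]
      refine Finset.sum_congr rfl fun k _ => ?_
      rw [← mul_add, dpState_succ]
      exact congrArg _ (exists_eq_dpBest F (V (t + 1)) t Finset.univ (v t (k t))
        (dpState F V (profile v k) t)).choose_spec.2.symm
    have hp : ∑ k : Fin T → Fin K, ∏ s, p s (k s) = 1 := by
      have h := Finset.prod_univ_sum (fun _ => Finset.univ) p
      rw [Fintype.piFinset_univ] at h
      rw [← h]
      simp [hp1]
    have h0 : g 0 = V 0 ∅ := by
      simp only [hg, dpState]
      rw [← Finset.sum_mul, hp, one_mul]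
    have hT : g T = 0 := by simp [hg, hV, onlineValue, dpValue_end]
    calc _ = ∑ t : Fin T, (g t - g (t + 1)) := by
          simp only [hstep, expectedWelfare, welfare, Finset.mul_sum]
          exact Finset.sum_comm
      _ = ∑ n ∈ Finset.range T, (g n - g (n + 1)) :=
          Fin.sum_univ_eq_sum_range (fun n => g n - g (n + 1)) T
      _ = V 0 ∅ := by rw [Finset.sum_range_sub', h0, hT, sub_zero]

end DynamicProgram

/-! ### The relaxed program: matroid constraint only -/

section MatroidProphet

open scoped Classical

variable {T : ℕ} {N : Fin T → Type*}

theorem pairwiseDisjoint_agentItems (V : ∀ t, Finset (N t)) (s : Set (Fin T)) :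
    s.PairwiseDisjoint fun t => agentItems t (V t) := by
  intro t _ t' _ hne
  refine Finset.disjoint_left.2 fun i hi hi' => hne ?_
  obtain ⟨a, _, rfl⟩ := mem_agentItems.1 hi
  obtain ⟨b, _, h⟩ := mem_agentItems.1 hi'
  exact (congrArg Sigma.fst h).symm

theorem sum_allocated (Y : ∀ t, Finset (N t)) (f : (Σ t, N t) → ℝ) :
    ∑ i ∈ allocated Y, f i = ∑ t, ∑ a ∈ Y t, f ⟨t, a⟩ :=
  Finset.sum_sigma _ _ _

theorem sum_filter_lt_succ (f : Fin T → ℝ) (t : Fin T) :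
    ∑ s ∈ Finset.univ.filter (fun s : Fin T => (s : ℕ) < t + 1), f s = f t + ∑ s ∈ Finset.univ.filter (fun s : Fin T => (s : ℕ) < t), f s := by
  have e : (Finset.univ.filter fun s : Fin T => (s : ℕ) < t + 1) =
      insert t (Finset.univ.filter fun s : Fin T => (s : ℕ) < t) := by
    ext s; simp [Fin.ext_iff]; omega
  rw [e, Finset.sum_insert (by simp)]

theorem sum_filter_le_eq_add (f : Fin T → ℝ) (t : Fin T) :
    ∑ s ∈ Finset.univ.filter (fun s : Fin T => (t : ℕ) ≤ s), f s = f t + ∑ s ∈ Finset.univ.filter (fun s : Fin T => (t : ℕ) + 1 ≤ s), f s := by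
  have e : (Finset.univ.filter fun s : Fin T => (t : ℕ) ≤ s) =
      insert t (Finset.univ.filter fun s : Fin T => (t : ℕ) + 1 ≤ s) := by
    ext s; simp [Fin.ext_iff]; omega
  rw [e, Finset.sum_insert (by simp)]

variable {Ω : Type*} [Fintype Ω]

/-- The optimal value-to-go when only the matroid constrains the allocation, and each agent `t`
draws a fresh sample `ω` and may get any subset of `R ω t`, with additive rewards `w ω`. -/
noncomputable def matroidValue (M : Matroid (Σ t, N t)) (q : Ω → ℝ) (R : Ω → ∀ t, Finset (N t))
    (w : Ω → (Σ t, N t) → ℝ) : ℕ → Finset (Σ t, N t) → ℝ :=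
  dpValue (fun Y => M.Indep (Y : Set (Σ t, N t))) (fun _ => q) (fun t ω => (R ω t).powerset)
    (fun t ω S => ∑ a ∈ S, w ω ⟨t, a⟩)

variable {M : Matroid (Σ t, N t)} {q : Ω → ℝ} {R : Ω → ∀ t, Finset (N t)}
  {w : Ω → (Σ t, N t) → ℝ}

/-- Independence is hereditary, so choices made from the larger state remain available. This matters
because skipping items because of the graph leads to a smaller state. -/
theorem matroidValue_antitone (hq0 : ∀ ω, 0 ≤ q ω) (n : ℕ) (hn : n ≤ T) :
    ∀ Y Y' : Finset (Σ t, N t), Y ⊆ Y' → matroidValue M q R w n Y' ≤ matroidValue M q R w n Y := by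
  refine backward_induction (P := fun n => ∀ Y Y' : Finset (Σ t, N t), Y ⊆ Y' →
    matroidValue M q R w n Y' ≤ matroidValue M q R w n Y) ?_ ?_ n hn
  · intro Y Y' _
    simp [matroidValue, dpValue_end]
  · intro t ih Y Y' h
    unfold matroidValue at ih ⊢
    rw [dpValue_fin, dpValue_fin]
    refine Finset.sum_le_sum fun ω _ => mul_le_mul_of_nonneg_left ?_ (hq0 ω)
    obtain ⟨S, hS, e⟩ := exists_eq_dpBest (fun Y => M.Indep (Y : Set (Σ t, N t)))
      (matroidValue M q R w (t + 1)) t (R ω t).powerset (fun S => ∑ a ∈ S, w ω ⟨t, a⟩) Y'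
    unfold matroidValue at e
    rw [← e]
    have hsub : Y ∪ agentItems t S ⊆ Y' ∪ agentItems t S := Finset.union_subset_union_left h
    refine le_trans (add_le_add le_rfl (ih _ _ hsub)) (le_dpBest _ (fun S => ∑ a ∈ S, w ω ⟨t, a⟩) ?_)
    rcases mem_dpOptions.1 hS with h0 | ⟨h1, h2⟩
    · exact mem_dpOptions.2 (Or.inl h0)
    · exact mem_dpOptions.2 (Or.inr ⟨h1, h2.subset (by exact_mod_cast hsub)⟩)

theorem le_matroidValue_of_free (hq0 : ∀ ω, 0 ≤ q ω) (hq1 : ∑ ω, q ω = 1)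
    (hM : ∀ X : Finset (Σ t, N t), M.Indep (X : Set (Σ t, N t))) :
    ∑ ω, q ω * ∑ i ∈ allocated (R ω), w ω i ≤ matroidValue M q R w 0 ∅ := by
  set u : Fin T → ℝ := fun t => ∑ ω, q ω * ∑ a ∈ R ω t, w ω ⟨t, a⟩ with hu
  have key := backward_induction (T := T) (P := fun n => ∀ Y : Finset (Σ t, N t),
    ∑ t ∈ Finset.univ.filter (fun t : Fin T => n ≤ (t : ℕ)), u t ≤ matroidValue M q R w n Y) ?_ ?_ 0 (Nat.zero_le T) ∅
  · refine le_trans (le_of_eq ?_) key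
    simp only [hu, Nat.zero_le, Finset.filter_true, sum_allocated, Finset.mul_sum]
    exact Finset.sum_comm
  · intro Y
    have e : (Finset.univ.filter fun t : Fin T => T ≤ (t : ℕ)) = ∅ := by
      ext t; simp
    simp [matroidValue, dpValue_end, e]
  · intro t ih Y
    rw [sum_filter_le_eq_add]
    have e : ∀ c : ℝ, c = ∑ ω, q ω * c := fun c => by rw [← Finset.sum_mul, hq1, one_mul]
    rw [e (∑ s ∈ Finset.univ.filter (fun s : Fin T => (t : ℕ) + 1 ≤ s), u s), hu, ← Finset.sum_add_distrib]
    unfold matroidValue at ih ⊢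
    rw [dpValue_fin]
    refine Finset.sum_le_sum fun ω _ => ?_
    rw [← mul_add]
    refine mul_le_mul_of_nonneg_left ?_ (hq0 ω)
    exact le_trans (add_le_add le_rfl (ih (Y ∪ agentItems t (R ω t))))
      (le_dpBest _ (fun S => ∑ a ∈ S, w ω ⟨t, a⟩) (mem_dpOptions.2 (Or.inr ⟨Finset.mem_powerset_self _, hM _⟩)))

variable [∀ t, Fintype (N t)]

/-- The items of agent `t` in a set of items. -/
noncomputable def agentPart (V : Finset (Σ t, N t)) (t : Fin T) : Finset (N t) :=
  Finset.univ.filter fun a => (⟨t, a⟩ : Σ t, N t) ∈ V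

theorem allocated_agentPart (V : Finset (Σ t, N t)) : allocated (agentPart V) = V := by
  ext ⟨t, a⟩
  simp [allocated, agentPart]

/-- Balanced prices give half of the value of the offline solutions. -/
theorem half_le_matroidValue (hq0 : ∀ ω, 0 ≤ q ω) (hq1 : ∑ ω, q ω = 1)
    (hR : ∀ ω, M.Indep (allocated (R ω) : Set (Σ t, N t))) (hw : ∀ ω i, 0 ≤ w ω i) :
    1 / 2 * ∑ ω, q ω * ∑ i ∈ allocated (R ω), w ω i ≤ matroidValue M q R w 0 ∅ := by
  choose h h0 hgreedy hloss using fun ω =>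
    exists_greedyValue M (Fin T) (allocated (R ω)) (w ω) fun i _ => hw ω i
  set F : Finset (Σ t, N t) → ℝ := fun Y => ∑ ω, q ω * h ω Y with hF
  set I : Finset (Σ t, N t) → Prop := fun Y => M.Indep (Y : Set (Σ t, N t)) with hI
  set best : Fin T → Ω → Finset (Σ t, N t) → ℝ := fun t ω Y =>
    dpBest I (fun Z => 1 / 2 * (F Z - F Y)) t (R ω t).powerset (fun S => ∑ a ∈ S, w ω ⟨t, a⟩) Y
    with hbest
  set u : Fin T → Finset (Σ t, N t) → ℝ := fun t Y => ∑ ω, q ω * best t ω Y with hu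
  have hconst : ∀ c : ℝ, ∑ ω, q ω * c = c := fun c => by rw [← Finset.sum_mul, hq1, one_mul]
  -- Past utilities plus value-to-go cover half of the residual value, for every fixed sequence of
  -- past states inside `Y n`. With the past fixed, the base case can compare all agents with one
  -- common outcome `ω`.
  have key := backward_induction (T := T) (P := fun n => ∀ Y : ℕ → Finset (Σ t, N t),
    (∀ s ≤ n, Y s ⊆ Y n) → I (Y n) →
      1 / 2 * F (Y n) ≤ ∑ t ∈ Finset.univ.filter (fun t : Fin T => (t : ℕ) < n), u t (Y t) + matroidValue M q R w n (Y n))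
    ?_ ?_ 0 (Nat.zero_le T) (fun _ => ∅) (by simp) (by simp [hI])
  · simp only [Nat.not_lt_zero, Finset.filter_false, Finset.sum_empty, zero_add] at key
    refine le_trans (le_of_eq ?_) key
    simp only [hF, h0 _ (hR _)]
  · intro Y hY hA
    -- In outcome `ω` each agent could have bought her part of the greedy extension `V ω` of the
    -- final set. By `hloss` the prices total at most half of `F (Y T)`, while `V ω` is worth `F (Y
    -- T)` on average.
    choose V hVR hAV hVI hVw using fun ω => hgreedy ω (Y T) hA
    have hVt : ∀ ω, Finset.univ.biUnion (fun t : Fin T => agentItems t (agentPart (V ω) t)) = V ω :=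
      fun ω => by rw [← allocated_eq_biUnion, allocated_agentPart]
    have hb : ∀ t ω, ∑ a ∈ agentPart (V ω) t, w ω ⟨t, a⟩ +
        1 / 2 * (F (Y t ∪ agentItems t (agentPart (V ω) t)) - F (Y t)) ≤ best t ω (Y t) := by
      intro t ω
      refine le_dpBest (fun Z => 1 / 2 * (F Z - F (Y t))) (fun S => ∑ a ∈ S, w ω ⟨t, a⟩)
        (mem_dpOptions.2 (Or.inr ⟨?_, ?_⟩))
      · rw [Finset.mem_powerset]
        intro a ha
        have : (⟨t, a⟩ : Σ t, N t) ∈ allocated (R ω) := hVR ω (by simpa [agentPart] using ha)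
        simpa [allocated] using this
      · refine (hVI ω).subset ?_
        have h1 : agentItems t (agentPart (V ω) t) ⊆ V ω := by
          intro i hi
          obtain ⟨a, ha, rfl⟩ := mem_agentItems.1 hi
          simpa [agentPart] using ha
        exact_mod_cast Finset.union_subset_union (hY t t.2.le) h1
    have hl : ∀ ω, ∑ t : Fin T, (F (Y t) - F (Y t ∪ agentItems t (agentPart (V ω) t))) ≤ F (Y T) := by
      intro ω
      simp only [hF, ← Finset.sum_sub_distrib, ← mul_sub]
      rw [Finset.sum_comm]
      refine Finset.sum_le_sum fun ω' _ => ?_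
      rw [← Finset.mul_sum]
      refine mul_le_mul_of_nonneg_left ?_ (hq0 ω')
      refine hloss ω' Finset.univ (Y T) (fun t : Fin T => Y t)
        (fun t : Fin T => agentItems t (agentPart (V ω) t)) (fun t _ => hY t t.2.le)
        (pairwiseDisjoint_agentItems _ _) ?_ ?_
      · rw [hVt]; exact hAV ω
      · rw [hVt]; exact hVI ω
    have hω : ∀ ω, h ω (Y T) - 1 / 2 * F (Y T) ≤ ∑ t : Fin T, best t ω (Y t) := by
      intro ω
      have e1 : ∑ i ∈ V ω, w ω i = ∑ t, ∑ a ∈ agentPart (V ω) t, w ω ⟨t, a⟩ := by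
        rw [← sum_allocated, allocated_agentPart]
      have e2 := Finset.sum_le_sum fun t (_ : t ∈ Finset.univ) => hb t ω
      rw [Finset.sum_add_distrib, ← e1, ← Finset.mul_sum] at e2
      have e3 : ∑ t : Fin T, (F (Y t ∪ agentItems t (agentPart (V ω) t)) - F (Y t)) =
          -∑ t : Fin T, (F (Y t) - F (Y t ∪ agentItems t (agentPart (V ω) t))) := by
        rw [← Finset.sum_neg_distrib]
        exact Finset.sum_congr rfl fun t _ => by ring
      rw [e3] at e2
      linarith [hl ω, hVw ω]
    have e4 : ∑ t ∈ Finset.univ.filter (fun t : Fin T => (t : ℕ) < T), u t (Y t) = ∑ ω, q ω * ∑ t : Fin T, best t ω (Y t) := by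
      simp only [hu, Finset.mul_sum, Fin.is_lt, Finset.filter_true]
      exact Finset.sum_comm
    have e5 := Finset.sum_le_sum fun ω (_ : ω ∈ Finset.univ) =>
      mul_le_mul_of_nonneg_left (hω ω) (hq0 ω)
    simp only [mul_sub, Finset.sum_sub_distrib, hconst] at e5
    rw [e4]
    simp only [matroidValue, dpValue_end, add_zero]
    have e6 : ∑ ω, q ω * h ω (Y T) = F (Y T) := rfl
    linarith
  · intro t ih Y hY hYI
    set C := ∑ s ∈ Finset.univ.filter (fun s : Fin T => (s : ℕ) < t), u s (Y s) with hC
    -- Play the utility-maximizing set. The induction hypothesis counts `u t (Y t)` as past utility;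
    -- it cancels once `best` is averaged over `ω`.
    have hb : ∀ ω, best t ω (Y t) + (1 / 2 * F (Y t) - C - u t (Y t)) ≤
        dpBest I (matroidValue M q R w (t + 1)) t (R ω t).powerset
          (fun S => ∑ a ∈ S, w ω ⟨t, a⟩) (Y t) := by
      intro ω
      obtain ⟨S, hS, e⟩ := exists_eq_dpBest I (fun Z => 1 / 2 * (F Z - F (Y t))) t
        (R ω t).powerset (fun S => ∑ a ∈ S, w ω ⟨t, a⟩) (Y t)
      have hle := le_dpBest (matroidValue M q R w (t + 1)) (fun S => ∑ a ∈ S, w ω ⟨t, a⟩) hS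
      have h1 := ih (Function.update Y (t + 1) (Y t ∪ agentItems t S)) ?_ ?_
      · rw [sum_filter_lt_succ] at h1
        have e1 : ∑ s ∈ Finset.univ.filter (fun s : Fin T => (s : ℕ) < t),
            u s (Function.update Y (t + 1) (Y t ∪ agentItems t S) s) = C := by
          refine Finset.sum_congr rfl fun s hs => ?_
          have hs := (Finset.mem_filter.1 hs).2
          rw [Function.update_of_ne (by omega)]
        rw [e1, Function.update_self, Function.update_of_ne (by omega)] at h1
        simp only [hbest]
        rw [← e]
        linarith
      · intro s hs
        rw [Function.update_self]
        rcases Nat.lt_or_eq_of_le hs with hs | rfl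
        · rw [Function.update_of_ne (by omega)]
          exact (hY s (by omega)).trans Finset.subset_union_left
        · rw [Function.update_self]
      · rw [Function.update_self]
        rcases mem_dpOptions.1 hS with rfl | h2
        · simpa using hYI
        · exact h2.2
    have e2 := Finset.sum_le_sum fun ω (_ : ω ∈ Finset.univ) =>
      mul_le_mul_of_nonneg_left (hb ω) (hq0 ω)
    simp only [mul_add, Finset.sum_add_distrib, hconst] at e2
    have e3 : matroidValue M q R w t (Y t) = ∑ ω, q ω *
        dpBest I (matroidValue M q R w (t + 1)) t (R ω t).powerset
          (fun S => ∑ a ∈ S, w ω ⟨t, a⟩) (Y t) := dpValue_fin _ _ _ _ t (Y t)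
    have e4 : ∑ ω, q ω * best t ω (Y t) = u t (Y t) := rfl
    rw [e3]
    linarith

end MatroidProphet

/-! ### Item prices for the graph constraint -/

section GraphPrices

open scoped Classical

variable {T : ℕ} {N : Fin T → Type*} [∀ t, Fintype (N t)]

/-- The neighbours of an item that belong to later agents. -/
noncomputable def laterNeighbors (G : SimpleGraph (Σ t, N t)) (i : Σ t, N t) :
    Finset (Σ t, N t) :=
  Finset.univ.filter fun i' => G.Adj i i' ∧ i.1 < i'.1

theorem mem_laterNeighbors {G : SimpleGraph (Σ t, N t)} {i i' : Σ t, N t} :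
    i' ∈ laterNeighbors G i ↔ G.Adj i i' ∧ i.1 < i'.1 := by
  simp [laterNeighbors]

/-- The solution `θ` of `θ i = f i (∑ θ i')`, where `i'` runs over the later neighbours of `i`. -/
noncomputable def backwardSolution (G : SimpleGraph (Σ t, N t)) (f : (Σ t, N t) → ℝ → ℝ)
    (i : Σ t, N t) : ℝ :=
  f i (∑ x : laterNeighbors G i, backwardSolution G f x.1)
termination_by T - i.1
decreasing_by
  have h : (i.1 : ℕ) < x.1.1 := (mem_laterNeighbors.1 x.2).2
  have := x.1.1.2
  omega

theorem backwardSolution_eq (G : SimpleGraph (Σ t, N t)) (f : (Σ t, N t) → ℝ → ℝ)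
    (i : Σ t, N t) :
    backwardSolution G f i = f i (∑ i' ∈ laterNeighbors G i, backwardSolution G f i') := by
  rw [backwardSolution, Finset.sum_coe_sort (laterNeighbors G i) (backwardSolution G f)]

theorem card_le_d2 {G : SimpleGraph (Σ t, N t)} {Y : Finset (Σ t, N t)}
    (hY : G.IsIndepSet (Y : Set (Σ t, N t))) (i : Σ t, N t) :
    (Y.filter fun i' => i ∈ laterNeighbors G i').card ≤ d2 G := by
  set s : Finset (earlierNeighbors G i) := Finset.univ.filter fun x => x.1 ∈ Y with hs
  have h1 : (Y.filter fun i' => i ∈ laterNeighbors G i').card = s.card := by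
    rw [← Finset.card_map (Function.Embedding.subtype _)]
    congr 1
    ext i'
    constructor
    · intro h
      obtain ⟨hi, h⟩ := Finset.mem_filter.1 h
      have h := mem_laterNeighbors.1 h
      exact Finset.mem_map.2 ⟨⟨i', h.1.symm, h.2⟩, by simpa [hs] using hi, rfl⟩
    · intro h
      obtain ⟨x, hx, rfl⟩ := Finset.mem_map.1 h
      exact Finset.mem_filter.2
        ⟨by simpa [hs] using hx, mem_laterNeighbors.2 ⟨x.2.1.symm, x.2.2⟩⟩
  have h2 : (G.induce (earlierNeighbors G i)).IsIndepSet (s : Set (earlierNeighbors G i)) := by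
    intro x hx y hy hne
    have hx : x.1 ∈ Y := by simpa [hs] using hx
    have hy : y.1 ∈ Y := by simpa [hs] using hy
    exact hY hx hy fun h => hne (Subtype.ext h)
  rw [h1]
  exact h2.card_le_indepNum.trans
    (Finset.le_sup (f := fun i => (G.induce (earlierNeighbors G i)).indepNum) (Finset.mem_univ i))

variable {Ω : Type*} [Fintype Ω]

/-- The expected net contribution of an item to the offline solution, after it has compensated
its later neighbours. -/
noncomputable def itemPrice (G : SimpleGraph (Σ t, N t)) (q : Ω → ℝ) (R : Ω → ∀ t, Finset (N t))
    (w : Ω → (Σ t, N t) → ℝ) : (Σ t, N t) → ℝ :=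
  backwardSolution G fun i c => ∑ ω, q ω * if i ∈ allocated (R ω) then max 0 (w ω i - c) else 0

/-- The compensation paid by an item to its later neighbours. -/
noncomputable def compensation (G : SimpleGraph (Σ t, N t)) (q : Ω → ℝ)
    (R : Ω → ∀ t, Finset (N t)) (w : Ω → (Σ t, N t) → ℝ) (i : Σ t, N t) : ℝ :=
  ∑ i' ∈ laterNeighbors G i, itemPrice G q R w i'

/-- The weight of an item, net of compensation. -/
noncomputable def netWeight (G : SimpleGraph (Σ t, N t)) (q : Ω → ℝ)
    (R : Ω → ∀ t, Finset (N t)) (w : Ω → (Σ t, N t) → ℝ) (ω : Ω) (i : Σ t, N t) : ℝ :=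
  max 0 (w ω i - compensation G q R w i)

variable {G : SimpleGraph (Σ t, N t)} {q : Ω → ℝ} {R : Ω → ∀ t, Finset (N t)}
  {w : Ω → (Σ t, N t) → ℝ}

theorem netWeight_nonneg (ω : Ω) (i : Σ t, N t) : 0 ≤ netWeight G q R w ω i := le_max_left _ _

theorem itemPrice_eq (i : Σ t, N t) : itemPrice G q R w i =
    ∑ ω, q ω * if i ∈ allocated (R ω) then netWeight G q R w ω i else 0 := by
  rw [itemPrice, backwardSolution_eq]
  rfl

theorem itemPrice_nonneg (hq0 : ∀ ω, 0 ≤ q ω) (i : Σ t, N t) : 0 ≤ itemPrice G q R w i := by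
  rw [itemPrice_eq]
  refine Finset.sum_nonneg fun ω _ => mul_nonneg (hq0 ω) ?_
  split_ifs
  exacts [netWeight_nonneg _ _, le_rfl]

theorem sum_itemPrice : ∑ i, itemPrice G q R w i =
    ∑ ω, q ω * ∑ i ∈ allocated (R ω), netWeight G q R w ω i := by
  simp only [itemPrice_eq]
  rw [Finset.sum_comm]
  refine Finset.sum_congr rfl fun ω _ => ?_
  rw [← Finset.mul_sum, Finset.sum_ite_mem, Finset.univ_inter]

/-- A weight is at most net weight plus compensation, and in the compensations of an independent set
each price occurs at most d₂ times (`card_le_d2`). -/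
theorem sum_weight_le_itemPrice (hq0 : ∀ ω, 0 ≤ q ω) (hq1 : ∑ ω, q ω = 1)
    (hR : ∀ ω, G.IsIndepSet (allocated (R ω) : Set (Σ t, N t))) :
    ∑ ω, q ω * ∑ i ∈ allocated (R ω), w ω i ≤
      ((d2 G : ℝ) + 1) * ∑ i, itemPrice G q R w i := by
  have hω : ∀ ω, ∑ i ∈ allocated (R ω), w ω i ≤ ∑ i ∈ allocated (R ω), netWeight G q R w ω i +
      d2 G * ∑ i, itemPrice G q R w i := by
    intro ω
    have h1 : ∑ i ∈ allocated (R ω), compensation G q R w i ≤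
        d2 G * ∑ i, itemPrice G q R w i := by
      calc ∑ i ∈ allocated (R ω), compensation G q R w i
          = ∑ i ∈ allocated (R ω), ∑ i',
              if i' ∈ laterNeighbors G i then itemPrice G q R w i' else 0 := by
            refine Finset.sum_congr rfl fun i _ => ?_
            rw [compensation, Finset.sum_ite_mem, Finset.univ_inter]
        _ = ∑ i', ((allocated (R ω)).filter fun i => i' ∈ laterNeighbors G i).card *
              itemPrice G q R w i' := by
            rw [Finset.sum_comm]
            refine Finset.sum_congr rfl fun i' _ => ?_
            rw [← Finset.sum_filter, Finset.sum_const, nsmul_eq_mul]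
        _ ≤ ∑ i', d2 G * itemPrice G q R w i' := by
            refine Finset.sum_le_sum fun i' _ =>
              mul_le_mul_of_nonneg_right ?_ (itemPrice_nonneg hq0 i')
            exact_mod_cast card_le_d2 (hR ω) i'
        _ = _ := by rw [Finset.mul_sum]
    have h2 : ∑ i ∈ allocated (R ω), (w ω i - compensation G q R w i) ≤
        ∑ i ∈ allocated (R ω), netWeight G q R w ω i :=
      Finset.sum_le_sum fun i _ => le_max_right _ _
    rw [Finset.sum_sub_distrib] at h2
    linarith
  have h := Finset.sum_le_sum fun ω (_ : ω ∈ Finset.univ) =>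
    mul_le_mul_of_nonneg_left (hω ω) (hq0 ω)
  simp only [mul_add, Finset.sum_add_distrib, ← sum_itemPrice] at h
  rw [← Finset.sum_mul, hq1] at h
  linarith

/-- The items of agents `t ≥ n` that are adjacent to an item of `Y`. -/
noncomputable def blockedItems (G : SimpleGraph (Σ t, N t)) (n : ℕ) (Y : Finset (Σ t, N t)) :
    Finset (Σ t, N t) :=
  Finset.univ.filter fun i => n ≤ i.1 ∧ ∃ i' ∈ Y, G.Adj i' i

/-- At the turn of agent `t` her blocked items leave the potential. By the price equation they
release exactly the expected net weight of the blocked part of `R ω t`. -/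
theorem sum_blockedItems_eq (t : Fin T) (Y : Finset (Σ t, N t)) :
    ∑ i ∈ blockedItems G t Y, itemPrice G q R w i =
      ∑ i ∈ blockedItems G (t + 1) Y, itemPrice G q R w i +
      ∑ ω, q ω * ∑ a ∈ R ω t with ∃ i' ∈ Y, G.Adj i' ⟨t, a⟩, netWeight G q R w ω ⟨t, a⟩ := by
  have e : blockedItems G t Y = blockedItems G (t + 1) Y ∪
      agentItems t (Finset.univ.filter fun a => ∃ i' ∈ Y, G.Adj i' ⟨t, a⟩) := by
    ext ⟨s, a⟩
    simp only [blockedItems, Finset.mem_filter, Finset.mem_univ, true_and, Finset.mem_union,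
      mem_agentItems]
    constructor
    · rintro ⟨h1, h2⟩
      rcases Nat.lt_or_eq_of_le h1 with h1 | h1
      · exact Or.inl ⟨h1, h2⟩
      · obtain rfl := Fin.ext h1
        exact Or.inr ⟨a, h2, rfl⟩
    · rintro (⟨h1, h2⟩ | ⟨b, h2, h⟩)
      · exact ⟨by omega, h2⟩
      · cases h
        exact ⟨le_rfl, h2⟩
  have hd : Disjoint (blockedItems G (t + 1) Y)
      (agentItems t (Finset.univ.filter fun a => ∃ i' ∈ Y, G.Adj i' ⟨t, a⟩)) := by
    refine Finset.disjoint_left.2 fun i hi hi' => ?_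
    obtain ⟨a, _, rfl⟩ := mem_agentItems.1 hi'
    have := (Finset.mem_filter.1 hi).2.1
    simp at this
  rw [e, Finset.sum_union hd, sum_agentItems]
  congr 1
  simp only [itemPrice_eq]
  rw [Finset.sum_comm]
  refine Finset.sum_congr rfl fun ω _ => ?_
  rw [← Finset.mul_sum, ← Finset.sum_filter]
  congr 2
  ext a
  simp [allocated, and_comm]

/-- A newly blocked item is a later neighbour of some element of `S`, whose compensation includes
its price. -/
theorem sum_blockedItems_union_le (hq0 : ∀ ω, 0 ≤ q ω) (t : Fin T) (Y : Finset (Σ t, N t))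
    (S : Finset (N t)) :
    ∑ i ∈ blockedItems G (t + 1) (Y ∪ agentItems t S), itemPrice G q R w i ≤
      ∑ i ∈ blockedItems G (t + 1) Y, itemPrice G q R w i +
      ∑ a ∈ S, compensation G q R w ⟨t, a⟩ := by
  set θ := itemPrice G q R w with hθ
  have h0 : ∀ i, 0 ≤ θ i := itemPrice_nonneg hq0
  have e : ∀ (X : Finset (Σ t, N t)), ∑ i ∈ X, θ i = ∑ i, if i ∈ X then θ i else 0 :=
    fun X => by rw [Finset.sum_ite_mem, Finset.univ_inter]
  simp only [compensation, ← hθ]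
  rw [e, e (blockedItems G (t + 1) Y), Finset.sum_congr rfl fun a _ => e _, Finset.sum_comm,
    ← Finset.sum_add_distrib]
  refine Finset.sum_le_sum fun i _ => ?_
  have hn : ∀ a ∈ S, 0 ≤ if i ∈ laterNeighbors G ⟨t, a⟩ then θ i else 0 := by
    intro a _
    split_ifs
    exacts [h0 i, le_rfl]
  have hn' : 0 ≤ if i ∈ blockedItems G (t + 1) Y then θ i else 0 := by
    split_ifs
    exacts [h0 i, le_rfl]
  by_cases hi : i ∈ blockedItems G (t + 1) (Y ∪ agentItems t S)
  · rw [if_pos hi]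
    obtain ⟨h1, i', hi', hadj⟩ := (Finset.mem_filter.1 hi).2
    rcases Finset.mem_union.1 hi' with hY | hS
    · rw [if_pos (show i ∈ blockedItems G (t + 1) Y from
        Finset.mem_filter.2 ⟨Finset.mem_univ _, h1, i', hY, hadj⟩)]
      linarith [Finset.sum_nonneg hn]
    · obtain ⟨a, ha, rfl⟩ := mem_agentItems.1 hS
      have h2 := Finset.single_le_sum hn ha
      rw [if_pos (mem_laterNeighbors.2 ⟨hadj, h1⟩)] at h2
      linarith
  · rw [if_neg hi]
    linarith [Finset.sum_nonneg hn]

end GraphPrices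

/-! ### Combining matroid and graph -/

section Main

open scoped Classical

variable {T K : ℕ} {N : Fin T → Type*} [∀ t, Fintype (N t)]

theorem IsCoupling.sum_marginal {p : Fin T → Fin K → ℝ} {q : (Fin T → Fin K) → ℝ}
    (hq : IsCoupling p q) (t : Fin T) (f : Fin K → ℝ) :
    ∑ j, p t j * f j = ∑ k, q k * f (k t) := by
  rw [← Finset.sum_fiberwise (s := Finset.univ) (g := fun k : Fin T → Fin K => k t)]
  refine Finset.sum_congr rfl fun j _ => ?_
  rw [← hq.marginal t j, Finset.sum_mul]
  exact Finset.sum_congr rfl fun k hk => by rw [(Finset.mem_filter.1 hk).2]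

theorem IsCoupling.pos_marginal {p : Fin T → Fin K → ℝ} {q : (Fin T → Fin K) → ℝ}
    (hq : IsCoupling p q) {k : Fin T → Fin K} (hk : 0 < q k) (t : Fin T) : 0 < p t (k t) := by
  rw [← hq.marginal t (k t)]
  exact hk.trans_le (Finset.single_le_sum (fun k _ => hq.nonneg k)
    (Finset.mem_filter.2 ⟨Finset.mem_univ k, rfl⟩))

variable {M : Matroid (Σ t, N t)} {G : SimpleGraph (Σ t, N t)} {p : Fin T → Fin K → ℝ}
  {v : ∀ t, Fin K → SetValuation (N t)} {q : (Fin T → Fin K) → ℝ}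
  {R : (Fin T → Fin K) → ∀ t, Finset (N t)} {w : (Fin T → Fin K) → (Σ t, N t) → ℝ}

theorem matroidValue_sub_le_onlineValue (hq : IsCoupling p q)
    (hR : ∀ k, G.IsIndepSet (allocated (R k) : Set (Σ t, N t)))
    (hw : ∀ k, 0 < q k → ∀ t S, ∑ a ∈ S, w k ⟨t, a⟩ ≤ v t (k t) S) (n : ℕ) (hn : n ≤ T) :
    ∀ Y, JointlyIndep M G Y → matroidValue M q R (netWeight G q R w) n Y -
      ∑ i ∈ blockedItems G n Y, itemPrice G q R w i ≤ onlineValue M G p v n Y := by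
  refine backward_induction (P := fun n => ∀ Y, JointlyIndep M G Y →
    matroidValue M q R (netWeight G q R w) n Y -
      ∑ i ∈ blockedItems G n Y, itemPrice G q R w i ≤ onlineValue M G p v n Y) ?_ ?_ n hn
  · intro Y _
    simp only [matroidValue, onlineValue, dpValue_end, zero_sub, Left.neg_nonpos_iff]
    exact Finset.sum_nonneg fun i _ => itemPrice_nonneg hq.nonneg i
  · intro t ih Y hY
    set W := matroidValue M q R (netWeight G q R w) with hW
    set V := onlineValue M G p v with hV
    set I : Finset (Σ t, N t) → Prop := fun Y => M.Indep (Y : Set (Σ t, N t)) with hI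
    have eW : W t Y = ∑ k, q k * dpBest I (W (t + 1)) t (R k t).powerset
        (fun S => ∑ a ∈ S, netWeight G q R w k ⟨t, a⟩) Y := dpValue_fin _ _ _ _ t Y
    have eV : V t Y = ∑ j, p t j *
        dpBest (JointlyIndep M G) (V (t + 1)) t Finset.univ (v t j) Y := dpValue_fin _ _ _ _ t Y
    -- Lifting the average over the agent's valuation to one over whole outcomes under `q` makes the
    -- comparison pointwise in `k`.
    rw [eW, eV, hq.sum_marginal t, sum_blockedItems_eq]
    have e : ∀ c : ℝ, c = ∑ k, q k * c := fun c => by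
      rw [← Finset.sum_mul, hq.sum_eq_one, one_mul]
    rw [e (∑ i ∈ blockedItems G (t + 1) Y, itemPrice G q R w i), ← Finset.sum_add_distrib,
      ← Finset.sum_sub_distrib]
    refine Finset.sum_le_sum fun k _ => ?_
    rw [← mul_add, ← mul_sub]
    rcases (hq.nonneg k).eq_or_lt with h0 | hk
    · simp [← h0]
    refine mul_le_mul_of_nonneg_left ?_ hk.le
    obtain ⟨S, hS, eS⟩ := exists_eq_dpBest I (W (t + 1)) t (R k t).powerset
      (fun S => ∑ a ∈ S, netWeight G q R w k ⟨t, a⟩) Y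
    rw [← eS]
    have hS' : S ⊆ R k t ∧ I (Y ∪ agentItems t S) := by
      rcases mem_dpOptions.1 hS with rfl | h
      · exact ⟨Finset.empty_subset _, by simpa [hI] using hY.1⟩
      · exact ⟨Finset.mem_powerset.1 h.1, h.2⟩
    -- The part of the relaxed choice `S` that is kept. Dropped blocked items are paid for by the
    -- released potential; the other dropped items have net weight zero.
    set S' := S.filter fun a =>
      (¬ ∃ i' ∈ Y, G.Adj i' ⟨t, a⟩) ∧ compensation G q R w ⟨t, a⟩ ≤ w k ⟨t, a⟩ with hS'def
    have hsub : Y ∪ agentItems t S' ⊆ Y ∪ agentItems t S :=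
      Finset.union_subset_union_right (Finset.map_subset_map.2 (Finset.filter_subset _ _))
    have hJ : JointlyIndep M G (Y ∪ agentItems t S') := by
      refine ⟨hS'.2.subset (by exact_mod_cast hsub), ?_⟩
      have hmem : ∀ i ∈ agentItems t S', i ∈ allocated (R k) ∧ ¬ ∃ i' ∈ Y, G.Adj i' i := by
        intro i hi
        obtain ⟨a, ha, rfl⟩ := mem_agentItems.1 hi
        have ha := Finset.mem_filter.1 ha
        exact ⟨by simpa [allocated] using hS'.1 ha.1, ha.2.1⟩
      intro i hi j hj hne hadj
      rcases Finset.mem_union.1 hi with hi | hi <;> rcases Finset.mem_union.1 hj with hj | hj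
      · exact hY.2 hi hj hne hadj
      · exact (hmem j hj).2 ⟨i, hi, hadj⟩
      · exact (hmem i hi).2 ⟨j, hj, hadj.symm⟩
      · exact hR k (hmem i hi).1 (hmem j hj).1 hne hadj
    have h1 := le_dpBest (F := JointlyIndep M G) (V (t + 1)) (v t (k t))
      (mem_dpOptions.2 (Or.inr ⟨Finset.mem_univ S', hJ⟩))
    have h2 := ih _ hJ
    have h3 := sum_blockedItems_union_le (G := G) (q := q) (R := R) (w := w) hq.nonneg t Y S'
    have h4 : W (t + 1) (Y ∪ agentItems t S) ≤ W (t + 1) (Y ∪ agentItems t S') :=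
      matroidValue_antitone hq.nonneg (t + 1) t.2 _ _ hsub
    have h5 := hw k hk t S'
    have h6 : ∑ a ∈ S, netWeight G q R w k ⟨t, a⟩ ≤
        ∑ a ∈ S', (w k ⟨t, a⟩ - compensation G q R w ⟨t, a⟩) +
        ∑ a ∈ R k t with ∃ i' ∈ Y, G.Adj i' ⟨t, a⟩, netWeight G q R w k ⟨t, a⟩ := by
      have h7 : ∑ a ∈ S with ∃ i' ∈ Y, G.Adj i' ⟨t, a⟩, netWeight G q R w k ⟨t, a⟩ ≤
          ∑ a ∈ R k t with ∃ i' ∈ Y, G.Adj i' ⟨t, a⟩, netWeight G q R w k ⟨t, a⟩ :=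
        Finset.sum_le_sum_of_subset_of_nonneg (Finset.filter_subset_filter _ hS'.1)
          fun a _ _ => netWeight_nonneg _ _
      refine le_trans ?_ (add_le_add le_rfl h7)
      rw [hS'def, Finset.sum_filter, Finset.sum_filter, ← Finset.sum_add_distrib]
      refine Finset.sum_le_sum fun a _ => ?_
      by_cases hb : ∃ i' ∈ Y, G.Adj i' ⟨t, a⟩
      · rw [if_pos hb, if_neg fun h => h.1 hb, zero_add]
      · rw [if_neg hb, add_zero]
        by_cases hc : compensation G q R w ⟨t, a⟩ ≤ w k ⟨t, a⟩
        · rw [if_pos ⟨hb, hc⟩, netWeight, max_eq_right (by linarith)]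
        · rw [if_neg fun h => hc h.2, netWeight, max_eq_left (by linarith)]
    rw [Finset.sum_sub_distrib] at h6
    linarith

theorem IsAdditive.eq_sum {α : Type*} {u : SetValuation α} (hu : IsAdditive u) (S : Finset α) :
    u S = ∑ a ∈ S, u {a} := by
  have h0 : u ∅ = 0 := by
    have h := hu ∅ ∅ (Finset.disjoint_empty_left _)
    rw [Finset.disjUnion_eq_union, Finset.union_empty] at h
    linarith
  induction S using Finset.induction_on with
  | empty => simp [h0]
  | insert a s ha ih =>
    rw [Finset.sum_insert ha, ← ih,
      hu {a} s (Finset.disjoint_singleton_left.2 ha), Finset.disjUnion_eq_union]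
    rfl

theorem IsXOS.exists_support {α : Type*} {u : SetValuation α} (hu : IsXOS u) (S : Finset α) :
    ∃ c : α → ℝ, (∀ S', ∑ a ∈ S', c a ≤ u S') ∧ ∑ a ∈ S, c a = u S := by
  obtain ⟨L, f, hf, hmax⟩ := hu
  obtain ⟨l, hl⟩ := (hmax S).1
  refine ⟨fun a => f l {a}, fun S' => ?_, ?_⟩
  · rw [← (hf l).eq_sum]
    exact (hmax S').2 ⟨l, rfl⟩
  · rw [← (hf l).eq_sum]
    exact hl

theorem exists_welfare_eq_maxWelfare (M : Matroid (Σ t, N t)) (G : SimpleGraph (Σ t, N t))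
    (u : ∀ t, SetValuation (N t)) : ∃ Y, Feasible M G Y ∧ welfare u Y = maxWelfare M G u := by
  obtain ⟨Y, hY, h⟩ := Finset.exists_mem_eq_sup' (s := Finset.univ.filter (Feasible M G))
    ⟨fun _ => ∅, by simp [feasible_empty]⟩ (welfare u)
  exact ⟨Y, (Finset.mem_filter.1 hY).2, h.symm⟩

theorem matroidFactor_le_matroidValue (M : Matroid (Σ t, N t)) (hM : M.E = Set.univ)
    (hq0 : ∀ k, 0 ≤ q k) (hq1 : ∑ k, q k = 1)
    (hR : ∀ k, M.Indep (allocated (R k) : Set (Σ t, N t))) (hw : ∀ k i, 0 ≤ w k i) :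
    1 / ((d1 M : ℝ) + 1) * ∑ k, q k * ∑ i ∈ allocated (R k), w k i ≤ matroidValue M q R w 0 ∅ := by
  by_cases h : ∀ S ⊆ M.E, M.Indep S
  · have e : d1 M = 0 := if_pos h
    rw [e]
    simpa using le_matroidValue_of_free (M := M) (R := R) (w := w) hq0 hq1
      fun X => h X (by simp [hM])
  · have e : d1 M = 1 := if_neg h
    rw [e]
    convert half_le_matroidValue hq0 hq1 hR hw using 2
    norm_num

theorem prophetWelfare_le_onlineValue (hM : M.E = Set.univ)
    (hv : ∀ t k, 0 < p t k → IsXOS (v t k)) (hq : IsCoupling p q) :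
    1 / (((d1 M : ℝ) + 1) * ((d2 G : ℝ) + 1)) * prophetWelfare M G v q ≤
      onlineValue M G p v 0 ∅ := by
  choose R hR hmax using fun k => exists_welfare_eq_maxWelfare M G (profile v k)
  have hc : ∀ k t, ∃ c : N t → ℝ, 0 < q k →
      (∀ S, ∑ a ∈ S, c a ≤ v t (k t) S) ∧ ∑ a ∈ R k t, c a = v t (k t) (R k t) := by
    intro k t
    by_cases hk : 0 < q k
    · obtain ⟨c, h⟩ := (hv t (k t) (hq.pos_marginal hk t)).exists_support (R k t)
      exact ⟨c, fun _ => h⟩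
    -- Outcomes of probability zero may contain valuations that are not XOS; their weights never
    -- count.
    · exact ⟨0, fun h => absurd h hk⟩
  choose c hc using hc
  set w : (Fin T → Fin K) → (Σ t, N t) → ℝ := fun k i => c k i.1 i.2 with hw
  have h1 := matroidValue_sub_le_onlineValue (M := M) (G := G) (R := R) (w := w) (v := v) hq
    (fun k => (hR k).2) (fun k hk t => (hc k t hk).1) 0 (Nat.zero_le T) ∅
    (by simp [JointlyIndep, SimpleGraph.IsIndepSet])
  have h2 := matroidFactor_le_matroidValue (R := R) (w := netWeight G q R w) M hM hq.nonneg
    hq.sum_eq_one (fun k => (hR k).1) (fun k i => netWeight_nonneg k i)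
  have h3 := sum_weight_le_itemPrice (G := G) (R := R) (w := w) hq.nonneg hq.sum_eq_one
    (fun k => (hR k).2)
  have h4 : blockedItems G 0 ∅ = ∅ := by simp [blockedItems]
  rw [h4, Finset.sum_empty, sub_zero] at h1
  rw [← sum_itemPrice] at h2
  have h5 : prophetWelfare M G v q = ∑ k, q k * ∑ i ∈ allocated (R k), w k i := by
    refine Finset.sum_congr rfl fun k _ => ?_
    rcases (hq.nonneg k).eq_or_lt with h0 | hk
    · simp [← h0]
    · rw [← hmax, sum_allocated]
      exact congrArg _ (Finset.sum_congr rfl fun t _ => (hc k t hk).2.symm)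
  rw [h5]
  refine le_trans ?_ (h2.trans h1)
  rw [one_div, mul_inv, mul_assoc, one_div]
  refine mul_le_mul_of_nonneg_left ?_ (by positivity)
  rw [inv_mul_le_iff₀ (by positivity)]
  exact h3

end Main

theorem theorem2 {T K : ℕ} {N : Fin T → Type*} [∀ t, Fintype (N t)]
    (M : Matroid (Σ t, N t)) (hM : M.E = Set.univ) (G : SimpleGraph (Σ t, N t))
    (p : Fin T → Fin K → ℝ) (hp0 : ∀ t k, 0 ≤ p t k) (hp1 : ∀ t, ∑ k, p t k = 1)
    (v : ∀ t, Fin K → SetValuation (N t)) (hv : ∀ t k, 0 < p t k → IsXOS (v t k)) :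
    ∃ A : OnlineAlgorithm M G,
      1 / (((d1 M : ℝ) + 1) * ((d2 G : ℝ) + 1)) * OPT M G p v ≤ expectedWelfare A p v := by
  obtain ⟨A, hA⟩ := exists_algorithm_expectedWelfare_eq M G p hp1 v
  refine ⟨A, ?_⟩
  rw [hA, one_div, inv_mul_le_iff₀ (by positivity)]
  -- `A` is fixed before the coupling, so one algorithm competes with all of them; the product
  -- coupling makes the set nonempty.
  refine csSup_le ⟨_, _, isCoupling_prod p hp0 hp1, rfl⟩ ?_
  rintro _ ⟨q, hq, rfl⟩
  rw [← inv_mul_le_iff₀ (by positivity), ← one_div]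
  exact prophetWelfare_le_onlineValue hM hv hq
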